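/- Let $X$ be an almost complex orbifold of complex dimension $n$: a Hausdorff, second countable space with, at each $p\in X$, a local chart $(V_p,G_p,\pi_p)$, where $V_p\subset\mathbf R^{2n}$ is an open ball centred at the origin $o$, the finite group $G_p$ acts smoothly on $V_p$ (not necessarily effectively), $\pi_p$ induces a homeomorphism of $V_p/G_p$ onto an open neighbourhood $U_p$ of $p$ with $\pi_p^{-1}(p)=\{o\}$, and for $q\in U_p$ the charts at $p$ and $q$ define the same germ of uniformizing systems at $q$; and with a smooth section $J$ of $\mathrm{End}(TX)$ such that $J^2=-\mathrm{Id}$. Let $\rho_p:G_p\to GL(T_oV_p,J)\cong GL(n,\mathbf C)$ be given by the differentials of the action at $o$. For $g\in G_p$ let $m_g$ be the order of $\rho_p(g)$ and write $\rho_p(g)$ as $\mathrm{diag}(e^{2\pi i m_{1,g}/m_g},\dots,e^{2\pi i m_{n,g}/m_g})$ with $0\le m_{i,g}<m_g$. On $\widetilde X=\{(p,(g)_{G_p}) : p\in X,\ g\in G_p\}$, where $(g)_{G_p}$ is the conjugacy class, put $\iota(p,(g)_{G_p})=\sum_{i=1}^n m_{i,g}/m_g\in\mathbf Q$. Let $T$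 be the set of classes of the equivalence relation on $\widetilde X$ generated by $(q,(h)_{G_q})\sim(p,(g)_{G_p})$ whenever $q\in U_p$, an injective homomorphism $G_q\to G_p$ given by injections of charts carries $h$ to $g$, and the corresponding point of $V_p$ over $q$ lies in the component through $o$ of the fixed-point set $V_p^g$ (automatic if $G_p$ acts linearly). For $(g)\in T$ let $X_{(g)}\subset\widetilde X$ be the corresponding class (a sector), locally uniformized at $(p,(g)_{G_p})$ by $V_p^g$; let $(g^{-1})$ denote the class of $(p,(g^{-1})_{G_p})$. Then $\iota$ is constant on each sector $X_{(g)}$. Its constant value $\iota_{(g)}$ satisfies, for every $(p,(g)_{G_p})\in X_{(g)}$: (1) $\iota_{(g)}$ is an integer if and only if $\rho_p(g)\in SL(n,\mathbf C)$; (2) $\iota_{(g)}+\iota_{(g^{-1})}=\mathrm{rank}(\rho_p(g)-I)$, and this equals the complex codimension $n-\dim_{\mathbf C}X_{(g)}$; here $V_p^g$ is, at each point of its component through $o$, a smooth submanifold of $V_p$ of real dimension $2\dim_{\mathbf C}X_{(g)}$; (3) consequently $\iota_{(g)}+\dim_{\mathbf C}X_{(g)}<n$ whenever $\rho_p(g)\ne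 I$. -/

import Mathlib

open scoped ContDiff

/-- The real Euclidean space of dimension `m`. -/
abbrev Euc (m : ℕ) : Type := EuclideanSpace ℝ (Fin m)

/-- An `m`-dimensional uniformizing system `(V, G, π)` of an open subset `π(V)` of `X`:
`V` is a connected open subset of `ℝ^m`, `G` is a finite group acting smoothly on `V`
(not necessarily effectively), and `π : V → X` is continuous, open, and its fibres are exactly
the `G`-orbits, i.e. it induces a homeomorphism of `V / G` with the open set `π(V)`.
The values of `act g` and `proj` outside `V` are irrelevant. -/
structure UniformizingSystem (X : Type*) [TopologicalSpace X] (m : ℕ) where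
  V : Set (Euc m)
  isOpen_V : IsOpen V
  isConnected_V : IsConnected V
  G : Type
  [group : Group G]
  [finite : Finite G]
  act : G → Euc m → Euc m
  act_mem : ∀ g, ∀ x ∈ V, act g x ∈ V
  act_one : ∀ x ∈ V, act 1 x = x
  act_mul : ∀ g h, ∀ x ∈ V, act (g * h) x = act g (act h x)
  smooth_act : ∀ g, ContDiffOn ℝ ∞ (act g) V
  proj : Euc m → X
  continuousOn_proj : ContinuousOn proj V
  isOpen_image_proj : ∀ W, W ⊆ V → IsOpen W → IsOpen (proj '' W)
  proj_eq_iff : ∀ x ∈ V, ∀ y ∈ V, proj x = proj y ↔ ∃ g, act g x = y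

attribute [instance] UniformizingSystem.group UniformizingSystem.finite

namespace UniformizingSystem

variable {X : Type*} [TopologicalSpace X] {m : ℕ}

/-- The open subset of `X` which is uniformized. -/
def U (S : UniformizingSystem X m) : Set X := S.proj '' S.V

/-- The fixed-point set `V^g`. -/
def fixedSet (S : UniformizingSystem X m) (g : S.G) : Set (Euc m) :=
  {x | x ∈ S.V ∧ S.act g x = x}

/-- An element of `G` lies in the kernel of the action if it fixes the whole of `V`. -/
def IsInKernel (S : UniformizingSystem X m) (g : S.G) : Prop := ∀ x ∈ S.V, S.act g x = x

end UniformizingSystem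

/-- An injection `(ψ, τ) : (V', G', π') → (V, G, π)` of uniformizing systems: a monomorphism
`τ : G' → G` restricting to an isomorphism of the kernels of the actions, and a `τ`-equivariant
smooth open embedding `ψ : V' → V` (an injective local diffeomorphism) lying over the
identity of `X`. -/
structure OrbInjection {X : Type*} [TopologicalSpace X] {m : ℕ}
    (S' S : UniformizingSystem X m) where
  τ : S'.G →* S.G
  τ_injective : Function.Injective τ
  isInKernel_iff : ∀ g', S.IsInKernel (τ g') ↔ S'.IsInKernel g'
  exists_of_isInKernel : ∀ g, S.IsInKernel g → ∃ g', τ g' = g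
  ψ : Euc m → Euc m
  ψ_mem : ∀ x ∈ S'.V, ψ x ∈ S.V
  ψ_injOn : Set.InjOn ψ S'.V
  smooth_ψ : ContDiffOn ℝ ∞ ψ S'.V
  isInvertible_fderiv : ∀ x ∈ S'.V, (fderiv ℝ ψ x).IsInvertible
  equivariant : ∀ g', ∀ x ∈ S'.V, ψ (S'.act g' x) = S.act (τ g') (ψ x)
  proj_ψ : ∀ x ∈ S'.V, S.proj (ψ x) = S'.proj x

/-- The pull-back along an injection of a field of endomorphisms of the tangent spaces. -/
noncomputable def OrbInjection.pullbackEnd {X : Type*} [TopologicalSpace X] {m : ℕ}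
    {S' S : UniformizingSystem X m} (i : OrbInjection S' S)
    (J : Euc m → (Euc m →L[ℝ] Euc m)) (x : Euc m) : Euc m →L[ℝ] Euc m :=
  (fderiv ℝ i.ψ x).inverse ∘L J (i.ψ x) ∘L fderiv ℝ i.ψ x

/-- Two uniformizing systems define the same germ at `q` if they induce (up to isomorphism)
the same uniformizing system of some neighbourhood of `q`. -/
def SameGermAt {X : Type*} [TopologicalSpace X] {m : ℕ} (q : X)
    (S₁ S₂ : UniformizingSystem X m) : Prop :=
  ∃ S : UniformizingSystem X m,
    q ∈ S.U ∧ Nonempty (OrbInjection S S₁) ∧ Nonempty (OrbInjection S S₂)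

/-- An `m`-dimensional orbifold structure on `X`: at every point `p` a local chart
`(V_p, G_p, π_p)`, where `V_p` is an open ball of `ℝ^m` centred at the origin and the origin is
the only point over `p`, such that for `q ∈ U_p` the charts at `p` and at `q` define the
same germ at `q`. -/
structure OrbifoldStructure (X : Type*) [TopologicalSpace X] (m : ℕ) where
  chart : X → UniformizingSystem X m
  chart_ball : ∀ p, ∃ r : ℝ, 0 < r ∧ (chart p).V = Metric.ball 0 r
  proj_eq_center_iff : ∀ p, ∀ x ∈ (chart p).V, (chart p).proj x = p ↔ x = 0
  compatible : ∀ p, ∀ q ∈ (chart p).U, SameGermAt q (chart p) (chart q)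

namespace OrbifoldStructure

variable {X : Type*} [TopologicalSpace X] {m : ℕ} (O : OrbifoldStructure X m)

/-- The local group `G_p`. -/
abbrev locGroup (p : X) : Type := (O.chart p).G

/-- The space `{(p, (g)) | p ∈ X, g ∈ G_p}`, where `(g)` is the conjugacy class of `g`
in `G_p`. -/
def Inertia : Type _ := Σ p : X, ConjClasses (O.locGroup p)

/-- The point `(p, (g))`. -/
def point (p : X) (g : O.locGroup p) : O.Inertia := ⟨p, ConjClasses.mk g⟩

/-- The connected component of the origin in the fixed-point set of `g ∈ G_p` in `V_p`.
(When `G_p` acts linearly on the ball `V_p`, this is the whole fixed-point set.) -/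
def centralFixedSet (p : X) (g : O.locGroup p) : Set (Euc m) :=
  connectedComponentIn ((O.chart p).fixedSet g) 0

/-- The elementary relation `(h)_{G_q} ∼ (g)_{G_p}` for `q ∈ U_p`: the element `h ∈ G_q` is
carried to `g ∈ G_p` by the injective homomorphism `G_q → G_p` coming from injections
`i : S → V_q` and `j : S → V_p` of a uniformizing system `S` of a neighbourhood of `q`. The
point of `V_p` over `q` which corresponds to the centre of `V_q` is automatically fixed by `g`;
it is required to lie in the same component of the fixed-point set as the centre of `V_p`, so
that `V_p^g / C(g)` contributes only its connected piece at `(p, (g))`. All choices of injections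
are allowed. -/
def SectorStep (a b : O.Inertia) : Prop :=
  ∃ (q p : X) (h : O.locGroup q) (g : O.locGroup p), a = O.point q h ∧ b = O.point p g ∧
    ∃ (S : UniformizingSystem X m) (i : OrbInjection S (O.chart q))
      (j : OrbInjection S (O.chart p)) (s : S.G) (x : Euc m),
      x ∈ S.V ∧ i.ψ x = 0 ∧ i.τ s = h ∧ j.τ s = g ∧ j.ψ x ∈ O.centralFixedSet p g

/-- The equivalence relation generated by the elementary relations. -/
def sectorSetoid : Setoid O.Inertia := Relation.EqvGen.setoid O.SectorStep

/-- The set `T` of equivalence classes, which indexes the sectors. -/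
def SectorIndex : Type _ := Quotient O.sectorSetoid

/-- The class in `T` of a point of the inertia space. -/
def sectorOf (a : O.Inertia) : O.SectorIndex := Quotient.mk O.sectorSetoid a

/-- The sector `X_(g)` with index `t = (g) ∈ T`. -/
def sector (t : O.SectorIndex) : Set O.Inertia := {a | O.sectorOf a = t}

end OrbifoldStructure

/-- Near `x ∈ A`, the set `A ⊆ ℝ^m` is a smooth submanifold of dimension `k`: in some local
diffeomorphism it becomes a `k`-dimensional linear subspace. -/
def IsSubmanifoldAt {m : ℕ} (A : Set (Euc m)) (x : Euc m) (k : ℕ) : Prop :=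
  x ∈ A ∧ ∃ φ : OpenPartialHomeomorph (Euc m) (Euc m), x ∈ φ.source ∧
    ContDiffOn ℝ ∞ φ φ.source ∧ ContDiffOn ℝ ∞ φ.symm φ.target ∧
    ∃ W : Submodule ℝ (Euc m), Module.finrank ℝ W = k ∧ ∀ y ∈ φ.source, y ∈ A ↔ φ y ∈ W

/-- The sector `X_(g)` has complex dimension `d`: at each of its points `(p, (g))`, the
manifold uniformizing it, that is `V_p^g` (the component through the centre), has
real dimension `2 d`. -/
def OrbifoldStructure.HasSectorComplexDim {X : Type*} [TopologicalSpace X] {m : ℕ}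
    (O : OrbifoldStructure X m) (t : O.SectorIndex) (d : ℕ) : Prop :=
  ∀ (p : X) (g : O.locGroup p), O.point p g ∈ O.sector t →
    ∀ y ∈ O.centralFixedSet p g, IsSubmanifoldAt ((O.chart p).fixedSet g) y (2 * d)

/-- An almost complex structure on an orbifold: a smooth section `J` of `End(TX)` with
`J² = -1`. It is given on each `V_p` by a smooth `G_p`-equivariant field of endomorphisms, and
these agree under all injections. (For an element of the local group, the equivariance forces
every component of the fixed-point set to have even codimension, so the fixed-point set is
everything or of codimension at least two.) -/
structure AlmostComplexStructure {X : Type*} [TopologicalSpace X] {m : ℕ}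
    (O : OrbifoldStructure X m) where
  J : X → Euc m → (Euc m →L[ℝ] Euc m)
  smooth_J : ∀ p, ContDiffOn ℝ ∞ (J p) (O.chart p).V
  J_sq : ∀ p, ∀ x ∈ (O.chart p).V, J p x * J p x = -1
  equivariant : ∀ p, ∀ g : O.locGroup p, ∀ x ∈ (O.chart p).V,
    fderiv ℝ ((O.chart p).act g) x ∘L J p x =
      J p ((O.chart p).act g x) ∘L fderiv ℝ ((O.chart p).act g) x
  compatible : ∀ (p q : X) (S : UniformizingSystem X m) (i : OrbInjection S (O.chart p))
    (j : OrbInjection S (O.chart q)), ∀ x ∈ S.V, i.pullbackEnd (J p) x = j.pullbackEnd (J q) x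

namespace OrbifoldStructure

variable {X : Type*} [TopologicalSpace X] {m : ℕ} (O : OrbifoldStructure X m)

lemma zero_mem (p : X) : (0 : Euc m) ∈ (O.chart p).V := by
  obtain ⟨r, hr, h⟩ := O.chart_ball p
  rw [h]; exact Metric.mem_ball_self hr

lemma proj_zero (p : X) : (O.chart p).proj 0 = p :=
  (O.proj_eq_center_iff p 0 (O.zero_mem p)).2 rfl

/-- The centre of `V_p` is fixed by `G_p`. -/
lemma act_zero (p : X) (g : O.locGroup p) : (O.chart p).act g 0 = 0 := by
  have h0 := O.zero_mem p
  have hm := (O.chart p).act_mem g 0 h0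
  rw [← O.proj_eq_center_iff p _ hm]
  rw [← ((O.chart p).proj_eq_iff 0 h0 _ hm).2 ⟨g, rfl⟩]
  exact O.proj_zero p

lemma differentiableAt_act (p : X) (g : O.locGroup p) :
    DifferentiableAt ℝ ((O.chart p).act g) 0 :=
  (((O.chart p).smooth_act g).contDiffAt
    ((O.chart p).isOpen_V.mem_nhds (O.zero_mem p))).differentiableAt (by simp)

lemma fderiv_act_one (p : X) :
    fderiv ℝ ((O.chart p).act 1) 0 = ContinuousLinearMap.id ℝ (Euc m) := by
  have h : (O.chart p).act 1 =ᶠ[nhds 0] id :=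
    Filter.eventuallyEq_of_mem ((O.chart p).isOpen_V.mem_nhds (O.zero_mem p))
      (fun x hx => (O.chart p).act_one x hx)
  rw [h.fderiv_eq, fderiv_id]

lemma fderiv_act_mul (p : X) (g h : O.locGroup p) :
    fderiv ℝ ((O.chart p).act (g * h)) 0 =
      fderiv ℝ ((O.chart p).act g) 0 ∘L fderiv ℝ ((O.chart p).act h) 0 := by
  have e : (O.chart p).act (g * h) =ᶠ[nhds 0] (O.chart p).act g ∘ (O.chart p).act h :=
    Filter.eventuallyEq_of_mem ((O.chart p).isOpen_V.mem_nhds (O.zero_mem p))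
      (fun x hx => (O.chart p).act_mul g h x hx)
  have hg : DifferentiableAt ℝ ((O.chart p).act g) ((O.chart p).act h 0) := by
    rw [O.act_zero]; exact O.differentiableAt_act p g
  rw [e.fderiv_eq, fderiv_comp 0 hg (O.differentiableAt_act p h), O.act_zero]

end OrbifoldStructure

namespace AlmostComplexStructure

variable {X : Type*} [TopologicalSpace X] {m : ℕ} {O : OrbifoldStructure X m}

/-- The tangent space of `V_p` at its centre, as a complex vector space
with multiplication by `i` given by `J`. -/
def TangentAt (_ : AlmostComplexStructure O) (_ : X) : Type := Euc m

noncomputable instance (A : AlmostComplexStructure O) (p : X) : AddCommGroup (A.TangentAt p) :=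
  inferInstanceAs (AddCommGroup (Euc m))

/-- The `ℝ`-algebra homomorphism `ℂ → End (T_o V_p)` sending `i` to `J`. -/
noncomputable def complexAction (A : AlmostComplexStructure O) (p : X) :
    ℂ →ₐ[ℝ] (Euc m →L[ℝ] Euc m) :=
  Complex.lift ⟨A.J p 0, A.J_sq p 0 (O.zero_mem p)⟩

noncomputable instance (A : AlmostComplexStructure O) (p : X) : Module ℂ (A.TangentAt p) :=
  Module.compHom (Euc m) (A.complexAction p).toRingHom

lemma complexAction_apply (A : AlmostComplexStructure O) (p : X) (c : ℂ) (v : Euc m) :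
    A.complexAction p c v = c.re • v + c.im • A.J p 0 v := by
  have h : A.complexAction p c =
      c.re • (1 : Euc m →L[ℝ] Euc m) + c.im • A.J p 0 := by
    simp [complexAction, Complex.lift, Complex.liftAux_apply, Algebra.algebraMap_eq_smul_one]
  rw [h]; rfl

lemma complexAction_comm (A : AlmostComplexStructure O) (p : X) (g : O.locGroup p) (c : ℂ)
    (v : Euc m) : fderiv ℝ ((O.chart p).act g) 0 (A.complexAction p c v) =
      A.complexAction p c (fderiv ℝ ((O.chart p).act g) 0 v) := by
  have h := DFunLike.congr_fun (A.equivariant p g 0 (O.zero_mem p)) v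
  rw [O.act_zero] at h
  rw [complexAction_apply, complexAction_apply, map_add, map_smul, map_smul]
  exact congrArg (fun w => _ + c.im • w) h

/-- The representation `ρ_p : G_p → GL(T_o V_p, J) ≅ GL(n, ℂ)` given by the differentials at the
centre. -/
noncomputable def rho (A : AlmostComplexStructure O) (p : X) :
    Representation ℂ (O.locGroup p) (A.TangentAt p) where
  toFun g :=
    { toFun := fun v => fderiv ℝ ((O.chart p).act g) 0 v
      map_add' := fun v w => map_add (fderiv ℝ ((O.chart p).act g) 0) v w
      map_smul' := fun c v => A.complexAction_comm p g c v }
  map_one' := by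
    ext v
    exact DFunLike.congr_fun (O.fderiv_act_one p) v
  map_mul' g h := by
    ext v
    exact DFunLike.congr_fun (O.fderiv_act_mul p g h) v

end AlmostComplexStructure

/-- For a linear map `f` of finite order `M` with diagonal form
`diag(e^{2πi m₁/M}, …, e^{2πi m_n/M})`, `0 ≤ m_i < M`, this is `∑ m_i / M`: the value `k` occurs
among the `m_i` as often as the dimension of the eigenspace for `e^{2πi k/M}` indicates. -/
noncomputable def shiftOfEnd {W : Type*} [AddCommGroup W] [Module ℂ W] (f : Module.End ℂ W) : ℚ :=
  ∑ k ∈ Finset.range (orderOf f), ((k : ℚ) / (orderOf f : ℚ)) *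
    (Module.finrank ℂ
      (f.eigenspace (Complex.exp (2 * Real.pi * Complex.I * k / (orderOf f : ℂ)))) : ℚ)

/-- If `f` is written as such a diagonal matrix, in any basis, then `shiftOfEnd f` is the sum of
the exponents, as it should be. -/
lemma shiftOfEnd_eq_sum {W : Type*} [AddCommGroup W] [Module ℂ W] (f : Module.End ℂ W) {n : ℕ}
    (b : Module.Basis (Fin n) ℂ W) (a : Fin n → ℕ) (ha : ∀ i, a i < orderOf f)
    (hb : ∀ i, f (b i) =
      Complex.exp (2 * Real.pi * Complex.I * a i / (orderOf f : ℂ)) • b i) :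
    shiftOfEnd f = ∑ i, (a i : ℚ) / (orderOf f : ℚ) := by
  classical
  set M := orderOf f with hM
  have key : ∀ k ∈ Finset.range M, Module.finrank ℂ (f.eigenspace
      (Complex.exp (2 * Real.pi * Complex.I * k / (M : ℂ)))) =
        (Finset.univ.filter (fun i => a i = k)).card := by
    intro k hk
    rw [Finset.mem_range] at hk
    have hM0 : M ≠ 0 := by omega
    have hinj : ∀ i, Complex.exp (2 * Real.pi * Complex.I * a i / (M : ℂ)) =
        Complex.exp (2 * Real.pi * Complex.I * k / (M : ℂ)) → a i = k := by
      intro i h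
      have hp := Complex.isPrimitiveRoot_exp M hM0
      have e : ∀ j : ℕ, Complex.exp (2 * Real.pi * Complex.I * j / (M : ℂ)) =
          Complex.exp (2 * Real.pi * Complex.I / (M : ℂ)) ^ j := by
        intro j; rw [← Complex.exp_nat_mul]; congr 1; ring
      rw [e, e] at h
      exact hp.pow_inj (ha i) hk h
    have hspan : f.eigenspace (Complex.exp (2 * Real.pi * Complex.I * k / (M : ℂ))) =
        Submodule.span ℂ (Set.range (fun i : {i // a i = k} => b i)) := by
      apply le_antisymm
      · intro v hv
        rw [Module.End.mem_eigenspace_iff] at hv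
        rw [← b.sum_repr v]
        refine Submodule.sum_mem _ (fun i _ => ?_)
        by_cases hi : a i = k
        · exact Submodule.smul_mem _ _ (Submodule.subset_span ⟨⟨i, hi⟩, rfl⟩)
        · have h1 : f v = ∑ j, (b.repr v j *
              Complex.exp (2 * Real.pi * Complex.I * a j / (M : ℂ))) • b j := by
            conv_lhs => rw [← b.sum_repr v, map_sum]
            simp only [map_smul, hb, smul_smul]
          have h2 := congrArg (fun w => b.repr w i) (h1.symm.trans hv)
          simp only [b.repr_sum_self, map_smul, Finsupp.smul_apply, smul_eq_mul] at h2
          have h3 : b.repr v i = 0 := by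
            by_contra h0
            rw [mul_comm] at h2
            exact hi (hinj i (mul_right_cancel₀ h0 h2))
          rw [h3, zero_smul]
          exact Submodule.zero_mem _
      · rw [Submodule.span_le]
        rintro _ ⟨⟨i, hi⟩, rfl⟩
        change b i ∈ f.eigenspace _
        rw [Module.End.mem_eigenspace_iff, hb, hi]
    have hli : LinearIndependent ℂ (fun i : {i // a i = k} => b i) :=
      b.linearIndependent.comp _ Subtype.val_injective
    rw [hspan, finrank_span_eq_card hli, Fintype.card_subtype]
  unfold shiftOfEnd
  rw [← hM, ← Finset.sum_fiberwise_of_maps_to (s := Finset.univ) (t := Finset.range M) (g := a)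
    (fun i _ => Finset.mem_range.2 (ha i))]
  refine Finset.sum_congr rfl (fun k hk => ?_)
  rw [key k hk, Finset.sum_congr rfl (g := fun _ => (k : ℚ) / (M : ℚ))
    (fun i hi => by rw [(Finset.mem_filter.1 hi).2])]
  rw [Finset.sum_const, nsmul_eq_mul, mul_comm]

lemma shiftOfEnd_conj {W : Type*} [AddCommGroup W] [Module ℂ W] (c : (Module.End ℂ W)ˣ)
    (f : Module.End ℂ W) :
    shiftOfEnd ((c : Module.End ℂ W) * f * ((c⁻¹ : (Module.End ℂ W)ˣ) : Module.End ℂ W)) =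
      shiftOfEnd f := by
  have ho : orderOf ((c : Module.End ℂ W) * f * ((c⁻¹ : (Module.End ℂ W)ˣ) : Module.End ℂ W)) =
      orderOf f := by
    rw [orderOf_eq_orderOf_iff]
    intro k
    rw [Units.conj_pow]
    constructor
    · intro h
      have h2 := congrArg (fun u => ((c⁻¹ : (Module.End ℂ W)ˣ) : Module.End ℂ W) * u *
        (c : Module.End ℂ W)) h
      simpa [mul_assoc] using h2
    · intro h; rw [h]; simp
  have hl : ∀ v : W, ((c⁻¹ : (Module.End ℂ W)ˣ) : Module.End ℂ W) ((c : Module.End ℂ W) v) = v :=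
    fun v => by rw [← Module.End.mul_apply, Units.inv_mul, Module.End.one_apply]
  have hr : ∀ v : W, (c : Module.End ℂ W) (((c⁻¹ : (Module.End ℂ W)ˣ) : Module.End ℂ W) v) = v :=
    fun v => by rw [← Module.End.mul_apply, Units.mul_inv, Module.End.one_apply]
  have hfin : ∀ μ : ℂ, Module.finrank ℂ (((c : Module.End ℂ W) * f *
      ((c⁻¹ : (Module.End ℂ W)ˣ) : Module.End ℂ W)).eigenspace μ) =
        Module.finrank ℂ (f.eigenspace μ) := by
    intro μ
    let e : W ≃ₗ[ℂ] W := LinearEquiv.ofLinearMap (c : Module.End ℂ W)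
      ((c⁻¹ : (Module.End ℂ W)ˣ) : Module.End ℂ W) (LinearMap.ext hr) (LinearMap.ext hl)
    have hm : (f.eigenspace μ).map (e : W →ₗ[ℂ] W) = ((c : Module.End ℂ W) * f *
        ((c⁻¹ : (Module.End ℂ W)ˣ) : Module.End ℂ W)).eigenspace μ := by
      ext v
      rw [Submodule.mem_map, Module.End.mem_eigenspace_iff]
      constructor
      · rintro ⟨w, hw, rfl⟩
        rw [Module.End.mem_eigenspace_iff] at hw
        change (c : Module.End ℂ W) (f (((c⁻¹ : (Module.End ℂ W)ˣ) : Module.End ℂ W)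
          ((c : Module.End ℂ W) w))) = μ • (c : Module.End ℂ W) w
        rw [hl, hw, map_smul]
      · intro h
        refine ⟨((c⁻¹ : (Module.End ℂ W)ˣ) : Module.End ℂ W) v, ?_, hr v⟩
        rw [Module.End.mem_eigenspace_iff]
        have h2 := congrArg ((c⁻¹ : (Module.End ℂ W)ˣ) : Module.End ℂ W) h
        rw [Module.End.mul_apply, Module.End.mul_apply, hl, map_smul] at h2
        exact h2
    rw [← hm]
    exact LinearEquiv.finrank_map_eq e _
  unfold shiftOfEnd
  rw [ho]
  simp only [hfin]

/-- The function `ι(p, (g)) = ∑ m_{i,g} / m_g` on the inertia space. -/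
noncomputable def AlmostComplexStructure.degreeShift {X : Type*} [TopologicalSpace X] {m : ℕ}
    {O : OrbifoldStructure X m} (A : AlmostComplexStructure O) : O.Inertia → ℚ :=
  fun a => Quotient.lift (fun g => shiftOfEnd (A.rho a.1 g)) (by
    intro g h hgh
    obtain ⟨c, hc⟩ := isConj_iff.1 hgh
    have h1 := shiftOfEnd_conj (Units.map (A.rho a.1) (toUnits c)) (A.rho a.1 g)
    rw [← h1, ← hc, map_mul, map_mul, ← map_inv]
    rfl) a.2

lemma AlmostComplexStructure.degreeShift_point {X : Type*} [TopologicalSpace X] {m : ℕ}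
    {O : OrbifoldStructure X m} (A : AlmostComplexStructure O) (p : X) (g : O.locGroup p) :
    A.degreeShift (O.point p g) = shiftOfEnd (A.rho p g) := rfl

/-! ### Linear algebra of complex endomorphisms of finite order. -/

section FiniteOrder

variable {W : Type*} [AddCommGroup W] [Module ℂ W]

/-! The shift depends only on the eigenvalue multiplicities of `ρ_p(g)`. At a point of `V_p^g` the
differential of `g` commutes with `J` and satisfies `T ^ N = 1`, so its eigenvalues lie in the
finite set of `N`-th roots of unity, and their multiplicities cannot jump along a connected set of
fixed points. Injections of charts intertwine both the differentials and `J`, so an elementary step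
preserves every multiplicity (`exists_finrank_eigenspace_eq_of_sectorStep`). Hence `ι` and the
dimension of the fixed space descend to sectors.

Since `J` varies with the point, multiplicities are counted by real linear algebra: the
`μ`-eigenspace is the real fixed space of `μ⁻¹ T`, whose dimension is the trace of an averaging
projection, a continuous and integer-valued quantity (`finrank_fixedSubspace_eq_of_isPreconnected`).

The numerical claims follow from a diagonal basis with exponents `a i < N`: the determinant is `exp
(2πi ι)`; inversion replaces a nonzero `a i` by `N - a i`, so each nontrivial eigenvalue contributes
`1` to the sum of the two shifts; and each `a i / N` is less than `1`. Averaging over the powers of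
`g` linearizes it near a fixed point, which makes `V_p^g` a submanifold with the dimension of the
fixed space of the differential. -/

lemma exp_two_pi_mul_div_eq_pow (N k : ℕ) :
    Complex.exp (2 * Real.pi * Complex.I * k / (N : ℂ)) =
      Complex.exp (2 * Real.pi * Complex.I / (N : ℂ)) ^ k := by
  rw [← Complex.exp_nat_mul]; congr 1; ring

/-- An endomorphism of finite order of a complex vector space is semisimple. -/
lemma Module.End.isSemisimple_of_pow_eq_one {f : Module.End ℂ W} {N : ℕ} (hN : N ≠ 0)
    (hf : f ^ N = 1) : f.IsSemisimple := by
  have hs : Squarefree (Polynomial.X ^ N - 1 : Polynomial ℂ) :=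
    (Polynomial.X_pow_sub_one_separable_iff.2 (by exact_mod_cast hN)).squarefree
  exact Module.End.isSemisimple_of_squarefree_aeval_eq_zero hs (by simp [hf])

/-- An eigenvalue of an endomorphism of order dividing `N` is an `N`-th root of unity. -/
lemma Module.End.pow_eq_one_of_hasEigenvector {f : Module.End ℂ W} {N : ℕ} (hf : f ^ N = 1)
    {μ : ℂ} {v : W} (hv : f v = μ • v) (hv0 : v ≠ 0) : μ ^ N = 1 := by
  have h : ∀ k : ℕ, (f ^ k) v = μ ^ k • v := by
    intro k
    induction k with
    | zero => simp
    | succ k ih => rw [pow_succ', Module.End.mul_apply, ih, map_smul, hv, smul_smul, pow_succ]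
  have h1 := h N
  rw [hf, Module.End.one_apply] at h1
  by_contra h2
  have h3 : (μ ^ N - 1) • v = 0 := by rw [sub_smul, ← h1, one_smul, sub_self]
  exact (smul_eq_zero.1 h3).elim (fun h => h2 (sub_eq_zero.1 h)) hv0

/-- An endomorphism of finite order is diagonal in some basis, its eigenvalues being
roots of unity. -/
lemma Module.End.exists_diagonal_basis [Module.Finite ℂ W] {f : Module.End ℂ W} {N : ℕ}
    (hN : N ≠ 0) (hf : f ^ N = 1) :
    ∃ (b : Module.Basis (Fin (Module.finrank ℂ W)) ℂ W) (a : Fin (Module.finrank ℂ W) → ℕ),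
      (∀ i, a i < N) ∧
      ∀ i, f (b i) = Complex.exp (2 * Real.pi * Complex.I * a i / (N : ℂ)) • b i := by
  have htop := (Module.End.isSemisimple_of_pow_eq_one hN hf).iSup_eigenspace_eq_top
  -- By semisimplicity the eigenvectors span, so a basis can be selected among them.
  obtain ⟨s, hs, hspan, hli⟩ := exists_linearIndependent ℂ {v : W | ∃ μ : ℂ, f v = μ • v}
  have hs_top : ⊤ ≤ Submodule.span ℂ s := by
    rw [hspan, ← htop]
    refine iSup_le fun μ v hv => Submodule.subset_span ⟨μ, Module.End.mem_eigenspace_iff.1 hv⟩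
  let b0 : Module.Basis s ℂ W := Module.Basis.mk hli (by simpa using hs_top)
  have hfin : Finite s := Module.Finite.finite_basis b0
  have : Fintype s := Fintype.ofFinite s
  let e : s ≃ Fin (Module.finrank ℂ W) :=
    Fintype.equivFinOfCardEq (Module.finrank_eq_card_basis b0).symm
  have key : ∀ x : s, ∃ k < N, f (b0 x) =
      Complex.exp (2 * Real.pi * Complex.I * k / (N : ℂ)) • b0 x := by
    intro x
    obtain ⟨μ, hμ⟩ := hs x.2
    have hx : b0 x = x := by simp [b0]
    have h1 := Module.End.pow_eq_one_of_hasEigenvector hf (by rw [hx]; exact hμ) (b0.ne_zero x)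
    have : NeZero N := ⟨hN⟩
    obtain ⟨k, hk, hk'⟩ := (Complex.isPrimitiveRoot_exp N hN).eq_pow_of_pow_eq_one h1
    refine ⟨k, hk, ?_⟩
    rw [exp_two_pi_mul_div_eq_pow, hk', hx]
    exact hμ
  choose a ha hfa using key
  refine ⟨b0.reindex e, fun i => a (e.symm i), fun i => ha _, fun i => ?_⟩
  rw [Module.Basis.reindex_apply]
  exact hfa _

/-- The codimension of the fixed space counts the eigenvalues different from `1`. -/
lemma Module.End.finrank_range_sub_one {f : Module.End ℂ W} {n : ℕ}
    (b : Module.Basis (Fin n) ℂ W) (μ : Fin n → ℂ) (hb : ∀ i, f (b i) = μ i • b i) :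
    Module.finrank ℂ (LinearMap.range (f - 1)) = (Finset.univ.filter (fun i => μ i ≠ 1)).card := by
  classical
  have h1 : ∀ i, (f - 1) (b i) = (μ i - 1) • b i := by
    intro i; rw [LinearMap.sub_apply, hb, Module.End.one_apply, sub_smul, one_smul]
  have hr : LinearMap.range (f - 1) =
      Submodule.span ℂ (Set.range (fun i : {i // μ i ≠ 1} => b i)) := by
    apply le_antisymm
    · rw [LinearMap.range_eq_map, ← b.span_eq, Submodule.map_span, Submodule.span_le]
      rintro _ ⟨_, ⟨i, rfl⟩, rfl⟩
      rw [h1]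
      by_cases hi : μ i = 1
      · simp [hi]
      · exact Submodule.smul_mem _ _ (Submodule.subset_span ⟨⟨i, hi⟩, rfl⟩)
    · rw [Submodule.span_le]
      rintro _ ⟨⟨i, hi⟩, rfl⟩
      refine ⟨(μ i - 1)⁻¹ • b i, ?_⟩
      rw [map_smul, h1, smul_smul, inv_mul_cancel₀ (sub_ne_zero.2 hi), one_smul]
  have hli : LinearIndependent ℂ (fun i : {i // μ i ≠ 1} => b i) :=
    b.linearIndependent.comp _ Subtype.val_injective
  rw [hr, finrank_span_eq_card hli, Fintype.card_subtype]

lemma LinearMap.det_of_diagonal_basis {f : Module.End ℂ W} {n : ℕ}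
    (b : Module.Basis (Fin n) ℂ W) (μ : Fin n → ℂ) (hb : ∀ i, f (b i) = μ i • b i) :
    LinearMap.det f = ∏ i, μ i := by
  classical
  rw [← LinearMap.det_toMatrix b]
  have : LinearMap.toMatrix b b f = Matrix.diagonal μ := by
    ext i j
    rw [LinearMap.toMatrix_apply, hb, map_smul, b.repr_self]
    by_cases h : i = j
    · subst h; simp
    · simp [h]
  rw [this, Matrix.det_diagonal]

lemma exp_two_pi_mul_div_eq_one_iff {N k : ℕ} (hk : k < N) :
    Complex.exp (2 * Real.pi * Complex.I * k / (N : ℂ)) = 1 ↔ k = 0 := by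
  rw [exp_two_pi_mul_div_eq_pow]
  constructor
  · intro h
    exact (Complex.isPrimitiveRoot_exp N (by omega)).pow_inj hk (by omega) (by simpa using h)
  · rintro rfl; simp

/-- The shift may be computed with any multiple of the order. -/
lemma shiftOfEnd_eq_sum_eigenspace {f : Module.End ℂ W} {N : ℕ} (hN : N ≠ 0) (hf : f ^ N = 1) :
    shiftOfEnd f = ∑ k ∈ Finset.range N, ((k : ℚ) / (N : ℚ)) * (Module.finrank ℂ
      (f.eigenspace (Complex.exp (2 * Real.pi * Complex.I * k / (N : ℂ)))) : ℚ) := by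
  obtain ⟨c, hc⟩ := orderOf_dvd_of_pow_eq_one hf
  have hM : orderOf f ≠ 0 := fun h => hN (by rw [hc, h, zero_mul])
  have hc0 : c ≠ 0 := fun h => hN (by rw [hc, h, mul_zero])
  have hMC : (orderOf f : ℂ) ≠ 0 := by exact_mod_cast hM
  have hcC : (c : ℂ) ≠ 0 := by exact_mod_cast hc0
  have hMQ : (orderOf f : ℚ) ≠ 0 := by exact_mod_cast hM
  have hcQ : (c : ℚ) ≠ 0 := by exact_mod_cast hc0
  have hinj : Set.InjOn (fun k => k * c) (Finset.range (orderOf f)) := fun x _ y _ h =>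
    Nat.eq_of_mul_eq_mul_right (Nat.pos_of_ne_zero hc0) h
  unfold shiftOfEnd
  symm
  -- With `N = orderOf f * c`, the exponent `k` for `orderOf f` is the exponent `k * c` for `N`,
  -- with the same fraction; the remaining exponents will have zero eigenspace.
  rw [← Finset.sum_subset (s₁ := (Finset.range (orderOf f)).image (fun k => k * c))]
  · rw [Finset.sum_image hinj]
    refine Finset.sum_congr rfl fun k _ => ?_
    have e1 : 2 * Real.pi * Complex.I * ((k * c : ℕ) : ℂ) / (N : ℂ) =
        2 * Real.pi * Complex.I * k / (orderOf f : ℂ) := by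
      nth_rewrite 1 [hc]; push_cast; field_simp
    have e2 : ((k * c : ℕ) : ℚ) / (N : ℚ) = (k : ℚ) / (orderOf f : ℚ) := by
      nth_rewrite 1 [hc]; push_cast; field_simp
    rw [e1, e2]
  · intro x hx
    obtain ⟨k, hk, rfl⟩ := Finset.mem_image.1 hx
    rw [Finset.mem_range] at hk ⊢
    rw [hc]
    exact Nat.mul_lt_mul_of_pos_right hk (Nat.pos_of_ne_zero hc0)
  · intro k _ hk'
    have hbot : f.eigenspace (Complex.exp (2 * Real.pi * Complex.I * k / (N : ℂ))) = ⊥ := by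
      rw [Submodule.eq_bot_iff]
      intro v hv
      by_contra hv0
      -- A nonzero eigenvector would force `orderOf f * c` to divide `k * orderOf f`, hence `c` to
      -- divide `k`.
      have h1 := Module.End.pow_eq_one_of_hasEigenvector (pow_orderOf_eq_one f)
        (Module.End.mem_eigenspace_iff.1 hv) hv0
      rw [exp_two_pi_mul_div_eq_pow, ← pow_mul,
        (Complex.isPrimitiveRoot_exp N hN).pow_eq_one_iff_dvd] at h1
      nth_rewrite 1 [hc] at h1
      rw [mul_comm (orderOf f) c] at h1
      obtain ⟨l, rfl⟩ := Nat.dvd_of_mul_dvd_mul_right (Nat.pos_of_ne_zero hM) h1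
      refine hk' (Finset.mem_image.2 ⟨l, ?_, mul_comm _ _⟩)
      rename_i hlt
      rw [Finset.mem_range] at hlt ⊢
      rw [hc, mul_comm (orderOf f) c] at hlt
      exact Nat.lt_of_mul_lt_mul_left hlt
    rw [hbot]; simp

variable [Module.Finite ℂ W] {f : Module.End ℂ W}

/-- The shift is an integer exactly when the determinant is `1`. -/
lemma exists_int_shiftOfEnd_iff (hf : IsOfFinOrder f) :
    (∃ k : ℤ, shiftOfEnd f = k) ↔ LinearMap.det f = 1 := by
  obtain ⟨b, a, ha, hb⟩ := Module.End.exists_diagonal_basis hf.orderOf_pos.ne' (pow_orderOf_eq_one f)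
  have hN := hf.orderOf_pos.ne'
  rw [shiftOfEnd_eq_sum f b a ha hb, LinearMap.det_of_diagonal_basis b _ hb, ← Complex.exp_sum,
    Complex.exp_eq_one_iff]
  -- The determinant is `exp (2πi · shift)`, so the same integer serves on both sides.
  refine exists_congr fun k => ?_
  have h2 : (2 * Real.pi * Complex.I : ℂ) ≠ 0 := by simp [Real.pi_ne_zero]
  have h3 : ∑ i, 2 * Real.pi * Complex.I * (a i : ℂ) / (orderOf f : ℂ) =
      ((∑ i, (a i : ℚ) / (orderOf f : ℚ) : ℚ) : ℂ) * (2 * Real.pi * Complex.I) := by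
    push_cast
    rw [Finset.sum_mul]
    exact Finset.sum_congr rfl fun i _ => by ring
  rw [h3, mul_left_inj' h2]
  norm_cast

/-- The shifts of `f` and `f⁻¹` add up to the codimension of the fixed space. -/
lemma shiftOfEnd_add_shiftOfEnd_inv (hf : IsOfFinOrder f) {f' : Module.End ℂ W} (hf' : f' * f = 1)
    (ho : orderOf f' = orderOf f) :
    shiftOfEnd f + shiftOfEnd f' = Module.finrank ℂ (LinearMap.range (f - 1)) := by
  have hN := hf.orderOf_pos.ne'
  obtain ⟨b, a, ha, hb⟩ := Module.End.exists_diagonal_basis hN (pow_orderOf_eq_one f)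
  set N := orderOf f with hNdef
  have hNC : (N : ℂ) ≠ 0 := by exact_mod_cast hN
  -- Exponents of the inverse eigenvalues. The exponent `0` stays `0`, as `N - 0` is out of range;
  -- so `(a i + a' i) / N` is `0` or `1`, according to whether the eigenvalue is `1`.
  let a' : Fin (Module.finrank ℂ W) → ℕ := fun i => if a i = 0 then 0 else N - a i
  have ha' : ∀ i, a' i < orderOf f' := by
    intro i; have := ha i; rw [ho]; simp only [a']; split_ifs <;> omega
  have hb' : ∀ i, f' (b i) =
      Complex.exp (2 * Real.pi * Complex.I * a' i / (orderOf f' : ℂ)) • b i := by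
    intro i
    rw [ho]
    have h1 : f' (f (b i)) = b i := by rw [← Module.End.mul_apply, hf', Module.End.one_apply]
    rw [hb, map_smul] at h1
    have h2 : Complex.exp (2 * Real.pi * Complex.I * a' i / (N : ℂ)) *
        Complex.exp (2 * Real.pi * Complex.I * a i / (N : ℂ)) = 1 := by
      rw [← Complex.exp_add, ← add_div, ← mul_add]
      by_cases h0 : a i = 0
      · simp [a', h0]
      · have h3 : (a' i : ℂ) + a i = N := by
          have : a' i + a i = N := by
            have := ha i
            simp only [a', h0, if_false]; omega
          exact_mod_cast this
        rw [h3, mul_div_assoc, div_self hNC, mul_one, Complex.exp_two_pi_mul_I]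
    calc f' (b i) = (Complex.exp (2 * Real.pi * Complex.I * a' i / (N : ℂ)) *
        Complex.exp (2 * Real.pi * Complex.I * a i / (N : ℂ))) • f' (b i) := by rw [h2, one_smul]
      _ = _ := by rw [mul_smul, h1]
  rw [shiftOfEnd_eq_sum f b a ha hb, shiftOfEnd_eq_sum f' b a' ha' hb',
    Module.End.finrank_range_sub_one b _ hb, ho, ← Finset.sum_add_distrib, Finset.card_filter,
    Nat.cast_sum]
  refine Finset.sum_congr rfl fun i _ => ?_
  have hNQ : (N : ℚ) ≠ 0 := by exact_mod_cast hN
  simp only [ne_eq, exp_two_pi_mul_div_eq_one_iff (ha i)]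
  by_cases h0 : a i = 0
  · simp [a', h0]
  · have : ((a' i : ℕ) : ℚ) = N - a i := by
      simp only [a', h0, if_false]
      rw [Nat.cast_sub (ha i).le]
    rw [← hNdef, this]
    simp only [h0, not_false_eq_true, if_true]
    field_simp
    simp

/-- The shift is smaller than the codimension of the fixed space, unless `f = 1`. -/
lemma shiftOfEnd_lt_finrank_range (hf : IsOfFinOrder f) (h1 : f ≠ 1) :
    shiftOfEnd f < Module.finrank ℂ (LinearMap.range (f - 1)) := by
  have hN := hf.orderOf_pos
  obtain ⟨b, a, ha, hb⟩ := Module.End.exists_diagonal_basis hN.ne' (pow_orderOf_eq_one f)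
  rw [shiftOfEnd_eq_sum f b a ha hb, Module.End.finrank_range_sub_one b _ hb, Finset.card_filter,
    Nat.cast_sum]
  have hNQ : (0 : ℚ) < orderOf f := by exact_mod_cast hN
  have hlt : ∀ i, (a i : ℚ) / orderOf f < 1 := fun i => by
    rw [div_lt_one hNQ]; exact_mod_cast ha i
  -- Terms with `a i = 0` contribute `0` to both sides; strictness comes from a nontrivial
  -- eigenvalue, which exists because `f ≠ 1`.
  have hex : ∃ i, a i ≠ 0 := by
    by_contra! h
    exact h1 (b.ext fun i => by rw [hb, h]; simp)
  obtain ⟨i, hi⟩ := hex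
  refine Finset.sum_lt_sum (fun j _ => ?_) ⟨i, Finset.mem_univ i, ?_⟩
  · simp only [ne_eq, exp_two_pi_mul_div_eq_one_iff (ha j)]
    by_cases h0 : a j = 0
    · simp [h0]
    · simpa [h0] using (hlt j).le
  · simp only [ne_eq, exp_two_pi_mul_div_eq_one_iff (ha i)]
    simpa [hi] using hlt i

end FiniteOrder

/-! ### Fixed spaces of real endomorphisms of finite order. -/

section RealFixed

variable {E : Type*} [NormedAddCommGroup E] [NormedSpace ℝ E]

/-- The fixed space of an endomorphism of a real normed space. -/
def fixedSubspace (T : E →L[ℝ] E) : Submodule ℝ E := LinearMap.ker (T - 1).toLinearMap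

lemma mem_fixedSubspace {T : E →L[ℝ] E} {v : E} : v ∈ fixedSubspace T ↔ T v = v := by
  change (T - 1) v = 0 ↔ _
  rw [sub_apply, sub_eq_zero]; rfl

/-- The dimension of the fixed space is the trace of the averaging projection. -/
lemma finrank_fixedSubspace_eq_trace [FiniteDimensional ℝ E] {T : E →L[ℝ] E} {N : ℕ} (hN : N ≠ 0)
    (hT : T ^ N = 1) : (Module.finrank ℝ (fixedSubspace T) : ℝ) =
      LinearMap.trace ℝ E ((N : ℝ)⁻¹ • ∑ j ∈ Finset.range N, T ^ j : E →L[ℝ] E).toLinearMap := by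
  have hNR : (N : ℝ) ≠ 0 := by exact_mod_cast hN
  have hp : LinearMap.IsProj (fixedSubspace T)
      ((N : ℝ)⁻¹ • ∑ j ∈ Finset.range N, T ^ j : E →L[ℝ] E).toLinearMap := by
    constructor
    · intro v
      -- `(T - 1) * ∑ T ^ j = T ^ N - 1 = 0`, so averages are fixed by `T`.
      have h := DFunLike.congr_fun (mul_geom_sum T N) v
      rw [hT, sub_self] at h
      change (T - 1) (((N : ℝ)⁻¹ • ∑ j ∈ Finset.range N, T ^ j : E →L[ℝ] E) v) = 0
      rw [smul_apply, map_smul]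
      have h' : (T - 1) ((∑ j ∈ Finset.range N, T ^ j : E →L[ℝ] E) v) = 0 := h
      rw [h', smul_zero]
    · intro v hv
      have hj : ∀ j : ℕ, (T ^ j) v = v := by
        intro j
        induction j with
        | zero => rfl
        | succ j ih =>
          rw [pow_succ]
          change (T ^ j) (T v) = v
          rw [mem_fixedSubspace.1 hv, ih]
      change ((N : ℝ)⁻¹ • ∑ j ∈ Finset.range N, T ^ j : E →L[ℝ] E) v = v
      rw [smul_apply, sum_apply]
      simp only [hj, Finset.sum_const, Finset.card_range]
      rw [← Nat.cast_smul_eq_nsmul ℝ, smul_smul, inv_mul_cancel₀ hNR, one_smul]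
  exact hp.trace.symm

/-- The dimension of the fixed space is constant in a continuous family of endomorphisms of
order dividing `N` over a preconnected set. -/
lemma finrank_fixedSubspace_eq_of_isPreconnected [FiniteDimensional ℝ E] {Y : Type*}
    [TopologicalSpace Y] {s : Set Y} (hs : IsPreconnected s) {T : Y → E →L[ℝ] E}
    (hc : ContinuousOn T s) {N : ℕ} (hN : N ≠ 0) (hT : ∀ y ∈ s, T y ^ N = 1) {x y : Y}
    (hx : x ∈ s) (hy : y ∈ s) :
    Module.finrank ℝ (fixedSubspace (T x)) = Module.finrank ℝ (fixedSubspace (T y)) := by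
  have htr : Continuous fun L : E →L[ℝ] E => LinearMap.trace ℝ E L.toLinearMap :=
    LinearMap.continuous_of_finiteDimensional
      ((LinearMap.trace ℝ E).comp (ContinuousLinearMap.coeLM ℝ))
  have h1 : ContinuousOn (fun y => (Module.finrank ℝ (fixedSubspace (T y)) : ℝ)) s := by
    refine ContinuousOn.congr (f := fun y => LinearMap.trace ℝ E
      ((N : ℝ)⁻¹ • ∑ j ∈ Finset.range N, T y ^ j : E →L[ℝ] E).toLinearMap) ?_
      fun y hy => finrank_fixedSubspace_eq_trace hN (hT y hy)
    refine htr.comp_continuousOn ?_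
    fun_prop
  -- The topology of `ℕ` is induced from `ℝ`, so the dimension is continuous into a discrete space.
  exact hs.constant (Nat.isClosedEmbedding_coe_real.isInducing.continuousOn_iff.2 h1) hx hy

/-- Intertwined endomorphisms have fixed spaces of the same dimension. -/
lemma finrank_fixedSubspace_eq_of_semiconj {T T' : E →L[ℝ] E} (B : E ≃L[ℝ] E)
    (h : ∀ v, B (T v) = T' (B v)) :
    Module.finrank ℝ (fixedSubspace T) = Module.finrank ℝ (fixedSubspace T') := by
  have hm : (fixedSubspace T).map (B.toLinearEquiv : E →ₗ[ℝ] E) = fixedSubspace T' := by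
    ext v
    rw [Submodule.mem_map]
    constructor
    · rintro ⟨w, hw, rfl⟩
      rw [mem_fixedSubspace] at hw ⊢
      change T' (B w) = B w
      rw [← h, hw]
    · intro hv
      refine ⟨B.symm v, ?_, B.apply_symm_apply v⟩
      rw [mem_fixedSubspace] at hv ⊢
      apply B.injective
      rw [h, B.apply_symm_apply, hv]
  rw [← hm]
  exact (LinearEquiv.finrank_map_eq B.toLinearEquiv _).symm

/-- The endomorphism `(a + b J) F`, for `β = a + b i`. -/
def twist (β : ℂ) (J F : E →L[ℝ] E) : E →L[ℝ] E := (β.re • (1 : E →L[ℝ] E) + β.im • J) * F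

lemma twist_apply (β : ℂ) (J F : E →L[ℝ] E) (v : E) :
    twist β J F v = β.re • F v + β.im • J (F v) := rfl

/-- The factor `a + b J` is the image of `β` under the algebra map `ℂ → End E` sending `i` to `J`,
and it commutes with `F`, so the two `N`-th powers can be taken separately. -/
lemma twist_pow_eq_one {β : ℂ} {J F : E →L[ℝ] E} (hJ : J * J = -1) (hJF : F * J = J * F) {N : ℕ}
    (hβ : β ^ N = 1) (hF : F ^ N = 1) : twist β J F ^ N = 1 := by
  have hl : β.re • (1 : E →L[ℝ] E) + β.im • J = Complex.lift ⟨J, hJ⟩ β := by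
    simp [Complex.lift, Complex.liftAux_apply, Algebra.algebraMap_eq_smul_one]
  have hc : Commute (β.re • (1 : E →L[ℝ] E) + β.im • J) F :=
    ((Commute.one_left F).smul_left _).add_left ((show Commute J F from hJF.symm).smul_left _)
  rw [twist, hc.mul_pow, hl, ← map_pow, hβ, map_one, hF, one_mul]

end RealFixed

/-! ### Differentials of the action at fixed points, and their behaviour under injections. -/

namespace UniformizingSystem

variable {X : Type*} [TopologicalSpace X] {m : ℕ} (S : UniformizingSystem X m)

lemma contDiffAt_act (g : S.G) {x : Euc m} (hx : x ∈ S.V) : ContDiffAt ℝ ∞ (S.act g) x :=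
  (S.smooth_act g).contDiffAt (S.isOpen_V.mem_nhds hx)

lemma differentiableAt_act (g : S.G) {x : Euc m} (hx : x ∈ S.V) :
    DifferentiableAt ℝ (S.act g) x :=
  (S.contDiffAt_act g hx).differentiableAt (by simp)

lemma fderiv_act_one {x : Euc m} (hx : x ∈ S.V) : fderiv ℝ (S.act 1) x = 1 := by
  have h : S.act 1 =ᶠ[nhds x] id :=
    Filter.eventuallyEq_of_mem (S.isOpen_V.mem_nhds hx) fun y hy => S.act_one y hy
  rw [h.fderiv_eq, fderiv_id]; rfl

lemma fderiv_act_mul (g h : S.G) {x : Euc m} (hx : x ∈ S.V) :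
    fderiv ℝ (S.act (g * h)) x =
      fderiv ℝ (S.act g) (S.act h x) ∘L fderiv ℝ (S.act h) x := by
  have e : S.act (g * h) =ᶠ[nhds x] S.act g ∘ S.act h :=
    Filter.eventuallyEq_of_mem (S.isOpen_V.mem_nhds hx) fun y hy => S.act_mul g h y hy
  rw [e.fderiv_eq, fderiv_comp x (S.differentiableAt_act g (S.act_mem h x hx))
    (S.differentiableAt_act h hx)]

variable {S}

lemma act_pow_of_mem_fixedSet {g : S.G} {x : Euc m} (hx : x ∈ S.fixedSet g) (k : ℕ) :
    S.act (g ^ k) x = x := by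
  induction k with
  | zero => rw [pow_zero]; exact S.act_one x hx.1
  | succ k ih => rw [pow_succ, S.act_mul _ _ _ hx.1, hx.2, ih]

/-- At a fixed point of `g`, the differential is multiplicative on powers of `g`. -/
lemma fderiv_act_pow {g : S.G} {x : Euc m} (hx : x ∈ S.fixedSet g) (k : ℕ) :
    fderiv ℝ (S.act (g ^ k)) x = fderiv ℝ (S.act g) x ^ k := by
  induction k with
  | zero => rw [pow_zero, pow_zero]; exact S.fderiv_act_one hx.1
  | succ k ih => rw [pow_succ, S.fderiv_act_mul _ _ hx.1, hx.2, ih, pow_succ]; rfl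

lemma fderiv_act_pow_eq_one {g : S.G} {x : Euc m} (hx : x ∈ S.fixedSet g) {N : ℕ}
    (hg : g ^ N = 1) : fderiv ℝ (S.act g) x ^ N = 1 := by
  rw [← fderiv_act_pow hx, hg, S.fderiv_act_one hx.1]

end UniformizingSystem

namespace OrbInjection

variable {X : Type*} [TopologicalSpace X] {m : ℕ} {S S' : UniformizingSystem X m}
  (i : OrbInjection S S')

/-- A point is fixed by `s` as soon as its image is fixed by `τ s`. -/
lemma mem_fixedSet_of_map {s : S.G} {x : Euc m} (hx : x ∈ S.V)
    (h : S'.act (i.τ s) (i.ψ x) = i.ψ x) : x ∈ S.fixedSet s :=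
  ⟨hx, i.ψ_injOn (S.act_mem s x hx) hx (by rw [i.equivariant s x hx, h])⟩

/-- Chain rule applied to the equivariance of `ψ`. Because `s` fixes `x`, both derivatives of `ψ`
are taken at `x`, so this is a conjugation. -/
lemma fderiv_comp_act {s : S.G} {x : Euc m} (hx : x ∈ S.fixedSet s) :
    fderiv ℝ i.ψ x ∘L fderiv ℝ (S.act s) x =
      fderiv ℝ (S'.act (i.τ s)) (i.ψ x) ∘L fderiv ℝ i.ψ x := by
  have hd : DifferentiableAt ℝ i.ψ x :=
    (i.smooth_ψ.contDiffAt (S.isOpen_V.mem_nhds hx.1)).differentiableAt (by simp)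
  have e : i.ψ ∘ S.act s =ᶠ[nhds x] S'.act (i.τ s) ∘ i.ψ :=
    Filter.eventuallyEq_of_mem (S.isOpen_V.mem_nhds hx.1) fun y hy => i.equivariant s y hy
  have h := e.fderiv_eq (𝕜 := ℝ)
  rwa [fderiv_comp x (by rw [hx.2]; exact hd) (S.differentiableAt_act s hx.1),
    fderiv_comp x (S'.differentiableAt_act _ (i.ψ_mem x hx.1)) hd, hx.2] at h

/-- The twisted differentials at corresponding points have fixed spaces of the same dimension. -/
lemma finrank_fixedSubspace_twist {s : S.G} {x : Euc m} (hx : x ∈ S.fixedSet s) (β : ℂ)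
    (J : Euc m → (Euc m →L[ℝ] Euc m)) :
    Module.finrank ℝ (fixedSubspace (twist β (i.pullbackEnd J x) (fderiv ℝ (S.act s) x))) =
      Module.finrank ℝ (fixedSubspace
        (twist β (J (i.ψ x)) (fderiv ℝ (S'.act (i.τ s)) (i.ψ x)))) := by
  obtain ⟨B, hB⟩ := i.isInvertible_fderiv x hx.1
  have hc := i.fderiv_comp_act hx
  -- The pull-back of `J` is conjugation by the same `B` that conjugates the differentials, so the
  -- twists are conjugate too.
  have hp : i.pullbackEnd J x = (B.symm : Euc m →L[ℝ] Euc m) ∘L J (i.ψ x) ∘L B := by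
    rw [pullbackEnd, ← hB, ContinuousLinearMap.inverse_equiv]
  rw [← hB] at hc
  refine finrank_fixedSubspace_eq_of_semiconj B fun v => ?_
  have hv : B (fderiv ℝ (S.act s) x v) = fderiv ℝ (S'.act (i.τ s)) (i.ψ x) (B v) :=
    DFunLike.congr_fun hc v
  rw [twist_apply, twist_apply, hp, map_add, map_smul, map_smul, ← hv]
  congr 2
  exact B.apply_symm_apply _

end OrbInjection

/-! ### Constancy of eigenvalue multiplicities along sectors. -/

namespace AlmostComplexStructure

variable {X : Type*} [TopologicalSpace X] {m : ℕ} {O : OrbifoldStructure X m}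
  (A : AlmostComplexStructure O)

lemma complex_smul_def (p : X) (c : ℂ) (v : A.TangentAt p) :
    c • v = (show A.TangentAt p from
      (c.re • (show Euc m from v) + c.im • A.J p 0 (show Euc m from v) : Euc m)) :=
  A.complexAction_apply p c v

/-- The real structure of `TangentAt` is restricted from `ℂ`; agreement with that of `Euc m` lets
real dimensions be computed there. -/
lemma real_smul_def (p : X) (c : ℝ) (v : A.TangentAt p) :
    c • v = (show A.TangentAt p from (c • (show Euc m from v) : Euc m)) := by
  change (c : ℂ) • v = _
  rw [complex_smul_def]
  simp only [Complex.ofReal_re, Complex.ofReal_im, zero_smul, add_zero]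
  rfl

/-- The tangent space with its two real structures. -/
noncomputable def tangentEquiv (p : X) : A.TangentAt p ≃ₗ[ℝ] Euc m where
  toFun v := v
  invFun v := v
  left_inv _ := rfl
  right_inv _ := rfl
  map_add' _ _ := rfl
  map_smul' c v := A.real_smul_def p c v

instance (p : X) : Module.Finite ℂ (A.TangentAt p) :=
  have : Module.Finite ℝ (A.TangentAt p) := Module.Finite.equiv (A.tangentEquiv p).symm
  Module.Finite.of_restrictScalars_finite ℝ ℂ _

lemma two_mul_finrank_tangentAt (p : X) : 2 * Module.finrank ℂ (A.TangentAt p) = m := by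
  rw [← finrank_real_of_complex, (A.tangentEquiv p).finrank_eq]; simp

/-- The differential of `g` at a point `y` of `V_p`, multiplied by `β`. -/
noncomputable def localTwist (p : X) (g : O.locGroup p) (β : ℂ) (y : Euc m) :
    Euc m →L[ℝ] Euc m :=
  twist β (A.J p y) (fderiv ℝ ((O.chart p).act g) y)

/-- At the centre, `β ρ_p(g) v = v` says that `v` is an eigenvector for `β⁻¹` or zero; the factor
`2` converts complex to real dimension. -/
lemma finrank_fixedSubspace_localTwist_zero (p : X) (g : O.locGroup p) {β : ℂ} (hβ : β ≠ 0) :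
    Module.finrank ℝ (fixedSubspace (A.localTwist p g β 0)) =
      2 * Module.finrank ℂ (Module.End.eigenspace (A.rho p g) β⁻¹) := by
  rw [← finrank_real_of_complex]
  have hm : ((Module.End.eigenspace (A.rho p g) β⁻¹).restrictScalars ℝ).map
      (A.tangentEquiv p : A.TangentAt p →ₗ[ℝ] Euc m) = fixedSubspace (A.localTwist p g β 0) := by
    ext v
    rw [Submodule.mem_map, mem_fixedSubspace]
    have key : ∀ w : A.TangentAt p, w ∈ Module.End.eigenspace (A.rho p g) β⁻¹ ↔
        β • A.rho p g w = w := fun w => by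
      rw [Module.End.mem_eigenspace_iff]
      constructor
      · intro h; rw [h, smul_inv_smul₀ hβ]
      · intro h; rw [← h, inv_smul_smul₀ hβ, h]
    have key2 : ∀ w : A.TangentAt p, β • A.rho p g w = w ↔
        A.localTwist p g β 0 (A.tangentEquiv p w) = A.tangentEquiv p w := fun w => by
      rw [complex_smul_def]; rfl
    constructor
    · rintro ⟨w, hw, rfl⟩
      exact (key2 w).1 ((key w).1 hw)
    · intro hv
      exact ⟨(A.tangentEquiv p).symm v, (key _).2 ((key2 _).2 hv), rfl⟩
  rw [← hm]
  exact LinearEquiv.finrank_map_eq (A.tangentEquiv p)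
    ((Module.End.eigenspace (A.rho p g) β⁻¹).restrictScalars ℝ)

lemma localTwist_pow_eq_one (p : X) {g : O.locGroup p} {β : ℂ} {N : ℕ} (hβ : β ^ N = 1)
    (hg : g ^ N = 1) {y : Euc m} (hy : y ∈ (O.chart p).fixedSet g) :
    A.localTwist p g β y ^ N = 1 := by
  refine twist_pow_eq_one (A.J_sq p y hy.1) ?_ hβ (UniformizingSystem.fderiv_act_pow_eq_one hy hg)
  have h := A.equivariant p g y hy.1
  -- At a fixed point, equivariance of `J` becomes commutation with the differential.
  rw [hy.2] at h
  exact h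

lemma continuousOn_localTwist (p : X) (g : O.locGroup p) (β : ℂ) :
    ContinuousOn (A.localTwist p g β) (O.chart p).V := by
  have h1 : ContinuousOn (fun y => fderiv ℝ ((O.chart p).act g) y) (O.chart p).V :=
    ((O.chart p).smooth_act g).continuousOn_fderiv_of_isOpen (O.chart p).isOpen_V (by simp)
  have h2 := (A.smooth_J p).continuousOn
  unfold localTwist twist
  fun_prop

/-- Along the component of the fixed-point set through the centre, the eigenvalues of the
differential of `g` keep their multiplicities. -/
lemma finrank_fixedSubspace_localTwist_eq (p : X) {g : O.locGroup p} {β : ℂ} {N : ℕ} (hN : N ≠ 0)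
    (hβ : β ^ N = 1) (hg : g ^ N = 1) {y : Euc m} (hy : y ∈ O.centralFixedSet p g) :
    Module.finrank ℝ (fixedSubspace (A.localTwist p g β y)) =
      Module.finrank ℝ (fixedSubspace (A.localTwist p g β 0)) := by
  have hsub : O.centralFixedSet p g ⊆ (O.chart p).fixedSet g := connectedComponentIn_subset _ _
  have h0 : (0 : Euc m) ∈ O.centralFixedSet p g :=
    mem_connectedComponentIn ⟨O.zero_mem p, O.act_zero p g⟩
  exact finrank_fixedSubspace_eq_of_isPreconnected isPreconnected_connectedComponentIn
    ((A.continuousOn_localTwist p g β).mono fun z hz => (hsub hz).1) hN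
    (fun z hz => A.localTwist_pow_eq_one p hβ hg (hsub hz)) hy h0

/-- Eigenvalues which are roots of unity have the same multiplicities at points of the inertia
space related by an elementary step. -/
lemma exists_finrank_eigenspace_eq_of_sectorStep {a b : O.Inertia} (hab : O.SectorStep a b) :
    ∃ (q p : X) (h : O.locGroup q) (g : O.locGroup p) (N : ℕ), a = O.point q h ∧ b = O.point p g ∧
      N ≠ 0 ∧ h ^ N = 1 ∧ g ^ N = 1 ∧ ∀ μ : ℂ, μ ^ N = 1 →
        Module.finrank ℂ (Module.End.eigenspace (A.rho q h) μ) =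
          Module.finrank ℂ (Module.End.eigenspace (A.rho p g) μ) := by
  obtain ⟨q, p, h, g, ha, hb, S, i, j, s, x, hx, hix, rfl, rfl, hjx⟩ := hab
  -- Both group elements are images of `s`, so its order is a common exponent.
  have hs : s ^ orderOf s = 1 := pow_orderOf_eq_one s
  have hN : orderOf s ≠ 0 := (orderOf_pos s).ne'
  refine ⟨q, p, _, _, orderOf s, ha, hb, hN, by rw [← map_pow, hs, map_one],
    by rw [← map_pow, hs, map_one], fun μ hμ => ?_⟩
  have hμ0 : μ ≠ 0 := by
    rintro rfl
    rw [zero_pow hN] at hμ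
    exact zero_ne_one hμ
  have hxs : x ∈ S.fixedSet s := i.mem_fixedSet_of_map hx (by rw [hix]; exact O.act_zero q _)
  have e1 := i.finrank_fixedSubspace_twist hxs μ⁻¹ (A.J q)
  have e2 := j.finrank_fixedSubspace_twist hxs μ⁻¹ (A.J p)
  -- The two pull-backs of `J` to `S` agree at `x`, which links the centre of `V_q` to the point
  -- `j.ψ x` of `V_p`; `e3` then moves from that point to the centre of `V_p`.
  rw [A.compatible q p S i j x hx, e2, hix] at e1
  have e3 := A.finrank_fixedSubspace_localTwist_eq p hN (β := μ⁻¹) (by rw [inv_pow, hμ, inv_one])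
    (by rw [← map_pow, hs, map_one]) hjx
  have e4 := A.finrank_fixedSubspace_localTwist_zero q (i.τ s) (inv_ne_zero hμ0)
  have e5 := A.finrank_fixedSubspace_localTwist_zero p (j.τ s) (inv_ne_zero hμ0)
  rw [inv_inv] at e4 e5
  have e6 : 2 * Module.finrank ℂ (Module.End.eigenspace (A.rho q (i.τ s)) μ) =
      2 * Module.finrank ℂ (Module.End.eigenspace (A.rho p (j.τ s)) μ) := by
    rw [← e4, ← e5, ← e3]; exact e1.symm
  omega

/-- Computing both shifts with the common exponent `N` avoids comparing the orders of the two
differentials. -/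
lemma degreeShift_eq_of_sectorStep {a b : O.Inertia} (hab : O.SectorStep a b) :
    A.degreeShift a = A.degreeShift b := by
  obtain ⟨q, p, h, g, N, rfl, rfl, hN, hh, hg, H⟩ :=
    A.exists_finrank_eigenspace_eq_of_sectorStep hab
  rw [degreeShift_point, degreeShift_point,
    shiftOfEnd_eq_sum_eigenspace hN (by rw [← map_pow, hh, map_one]),
    shiftOfEnd_eq_sum_eigenspace hN (by rw [← map_pow, hg, map_one])]
  refine Finset.sum_congr rfl fun k _ => ?_
  rw [H]
  rw [exp_two_pi_mul_div_eq_pow, ← pow_mul, mul_comm k N, pow_mul,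
    (Complex.isPrimitiveRoot_exp N hN).pow_eq_one, one_pow]

/-- The complex dimension of the fixed space of `ρ_p(g)`. -/
noncomputable def fixedDim : O.Inertia → ℕ :=
  fun a => Quotient.lift (fun g => Module.finrank ℂ (Module.End.eigenspace (A.rho a.1 g) 1)) (by
    intro g h hgh
    obtain ⟨c, rfl⟩ := isConj_iff.1 hgh
    have hc : ∀ v, A.rho a.1 c⁻¹ (A.rho a.1 c v) = v := fun v => by
      rw [← Module.End.mul_apply, ← map_mul, inv_mul_cancel, map_one, Module.End.one_apply]
    have hc' : ∀ v, A.rho a.1 c (A.rho a.1 c⁻¹ v) = v := fun v => by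
      rw [← Module.End.mul_apply, ← map_mul, mul_inv_cancel, map_one, Module.End.one_apply]
    let e : A.TangentAt a.1 ≃ₗ[ℂ] A.TangentAt a.1 :=
      LinearEquiv.ofLinearMap (A.rho a.1 c) (A.rho a.1 c⁻¹) (LinearMap.ext hc') (LinearMap.ext hc)
    have hm : (Module.End.eigenspace (A.rho a.1 g) 1).map (e : A.TangentAt a.1 →ₗ[ℂ] A.TangentAt a.1) =
        Module.End.eigenspace (A.rho a.1 (c * g * c⁻¹)) 1 := by
      ext v
      rw [Submodule.mem_map, Module.End.mem_eigenspace_iff, one_smul, map_mul, map_mul,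
        Module.End.mul_apply, Module.End.mul_apply]
      constructor
      · rintro ⟨w, hw, rfl⟩
        rw [Module.End.mem_eigenspace_iff, one_smul] at hw
        change A.rho a.1 c (A.rho a.1 g (A.rho a.1 c⁻¹ (A.rho a.1 c w))) = A.rho a.1 c w
        rw [hc, hw]
      · intro hv
        refine ⟨A.rho a.1 c⁻¹ v, ?_, hc' v⟩
        rw [Module.End.mem_eigenspace_iff, one_smul]
        conv_rhs => rw [← hv, hc]
    change Module.finrank ℂ (Module.End.eigenspace (A.rho a.1 g) 1) =
      Module.finrank ℂ (Module.End.eigenspace (A.rho a.1 (c * g * c⁻¹)) 1)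
    rw [← hm]
    exact (LinearEquiv.finrank_map_eq e _).symm) a.2

lemma fixedDim_point (p : X) (g : O.locGroup p) :
    A.fixedDim (O.point p g) = Module.finrank ℂ (Module.End.eigenspace (A.rho p g) 1) := rfl

lemma fixedDim_eq_of_sectorStep {a b : O.Inertia} (hab : O.SectorStep a b) :
    A.fixedDim a = A.fixedDim b := by
  obtain ⟨q, p, h, g, N, rfl, rfl, -, -, -, H⟩ :=
    A.exists_finrank_eigenspace_eq_of_sectorStep hab
  exact H 1 (one_pow N)

end AlmostComplexStructure

/-- A function on the inertia space which is invariant under elementary steps descends to the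
set of sectors. -/
lemma OrbifoldStructure.eq_of_eqvGen {X : Type*} [TopologicalSpace X] {m : ℕ}
    {O : OrbifoldStructure X m} {α : Type*} {f : O.Inertia → α}
    (hf : ∀ a b, O.SectorStep a b → f a = f b) {a b : O.Inertia}
    (h : Relation.EqvGen O.SectorStep a b) : f a = f b := by
  induction h with
  | rel a b h => exact hf a b h
  | refl a => rfl
  | symm a b _ ih => exact ih.symm
  | trans a b c _ _ ih1 ih2 => exact ih1.trans ih2

/-! ### Linearization of the action and smoothness of fixed-point sets. -/

/-- A smooth map of `ℝ^m` whose derivative at `y` is the identity restricts to a smooth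
diffeomorphism of open sets near `y`, inside any given open neighbourhood. -/
lemma exists_diffeomorph_of_fderiv_eq_one {m : ℕ} {V : Set (Euc m)} (hV : IsOpen V)
    {f : Euc m → Euc m} (hf : ContDiffOn ℝ ∞ f V) {y : Euc m} (hy : y ∈ V)
    (hfy : fderiv ℝ f y = 1) :
    ∃ φ : OpenPartialHomeomorph (Euc m) (Euc m), y ∈ φ.source ∧ φ.source ⊆ V ∧ ⇑φ = f ∧
      ContDiffOn ℝ ∞ φ φ.source ∧ ContDiffOn ℝ ∞ φ.symm φ.target := by
  have hfa : ∀ x ∈ V, ContDiffAt ℝ ∞ f x := fun x hx => hf.contDiffAt (hV.mem_nhds hx)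
  have hd : HasFDerivAt f ((ContinuousLinearEquiv.refl ℝ (Euc m) : Euc m ≃L[ℝ] Euc m) :
      Euc m →L[ℝ] Euc m) y := by
    have h := ((hfa y hy).differentiableAt (by simp)).hasFDerivAt
    rw [hfy] at h
    exact h
  let φ₀ := (hfa y hy).toOpenPartialHomeomorph f hd (by simp)
  have hc : ContinuousOn (fderiv ℝ f) V := hf.continuousOn_fderiv_of_isOpen hV (by simp)
  -- Restricting to the open set where the derivative is invertible makes the inverse smooth on the
  -- whole target, not only at the image of `y`.
  let V' : Set (Euc m) := V ∩ fderiv ℝ f ⁻¹' Set.range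
    ((↑) : (Euc m ≃L[ℝ] Euc m) → (Euc m →L[ℝ] Euc m))
  have hV' : IsOpen V' := hc.isOpen_inter_preimage hV ContinuousLinearEquiv.isOpen
  have hyV' : y ∈ V' := ⟨hy, ContinuousLinearEquiv.refl ℝ (Euc m), hfy.symm⟩
  refine ⟨φ₀.restrOpen V' hV', ⟨(hfa y hy).mem_toOpenPartialHomeomorph_source hd (by simp), hyV'⟩,
    fun x hx => hx.2.1, rfl, ?_, ?_⟩
  · exact hf.mono fun x hx => hx.2.1
  · intro z hz
    set φ := φ₀.restrOpen V' hV'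
    have hx : φ.symm z ∈ φ.source := φ.map_target hz
    obtain ⟨B, hB⟩ := hx.2.2
    have hdx : HasFDerivAt φ (B : Euc m →L[ℝ] Euc m) (φ.symm z) := by
      rw [hB]
      exact ((hfa _ hx.2.1).differentiableAt (by simp)).hasFDerivAt
    exact (φ.contDiffAt_symm hz hdx (hfa _ hx.2.1)).contDiffWithinAt

namespace UniformizingSystem

variable {X : Type*} [TopologicalSpace X] {m : ℕ} {S : UniformizingSystem X m}

/-- Near a fixed point `y` of `g` there are coordinates in which `g` acts linearly. -/
lemma exists_linearization {g : S.G} {y : Euc m} (hy : y ∈ S.fixedSet g) :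
    ∃ φ : OpenPartialHomeomorph (Euc m) (Euc m), y ∈ φ.source ∧ φ.source ⊆ S.V ∧
      ContDiffOn ℝ ∞ φ φ.source ∧ ContDiffOn ℝ ∞ φ.symm φ.target ∧
      ∀ z ∈ S.V, φ (S.act g z) = fderiv ℝ (S.act g) y (φ z) := by
  set T := fderiv ℝ (S.act g) y with hTdef
  set N := orderOf g
  have hg : g ^ N = 1 := pow_orderOf_eq_one g
  have hN : N ≠ 0 := (orderOf_pos g).ne'
  have hNR : (N : ℝ) ≠ 0 := by exact_mod_cast hN
  have hT : T ^ N = 1 := fderiv_act_pow_eq_one hy hg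
  -- Since `T ^ N = 1`, `T ^ (N - j)` is `T⁻ʲ`. The mean `f` of `T⁻ʲ (gʲ z - y)` over a period
  -- conjugates `g` to `T`, and each term has derivative `1` at `y`.
  let F : ℕ → Euc m → Euc m := fun j z => (T ^ (N - j)) (S.act (g ^ j) z - y)
  let f : Euc m → Euc m := fun z => (N : ℝ)⁻¹ • ∑ j ∈ Finset.range N, F j z
  have hF : ∀ j, ContDiffOn ℝ ∞ (F j) S.V := fun j =>
    (T ^ (N - j)).contDiff.comp_contDiffOn ((S.smooth_act _).sub contDiffOn_const)
  have hf : ContDiffOn ℝ ∞ f S.V :=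
    (ContDiffOn.sum fun j _ => hF j).const_smul _
  have hdF : ∀ j ∈ Finset.range N, HasFDerivAt (F j) (1 : Euc m →L[ℝ] Euc m) y := by
    intro j hj
    have h1 := (S.differentiableAt_act (g ^ j) hy.1).hasFDerivAt
    rw [fderiv_act_pow hy] at h1
    have h2 := (T ^ (N - j)).hasFDerivAt.comp y (h1.sub_const y)
    have h3 : (T ^ (N - j)) ∘L (T ^ j) = 1 := by
      change T ^ (N - j) * T ^ j = 1
      rw [← pow_add, Nat.sub_add_cancel (Finset.mem_range.1 hj).le, hT]
    rw [← hTdef, h3] at h2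
    exact h2
  have hdf : fderiv ℝ f y = 1 := by
    have h := (HasFDerivAt.fun_sum hdF).const_smul (N : ℝ)⁻¹
    rw [Finset.sum_const, Finset.card_range, ← Nat.cast_smul_eq_nsmul ℝ, smul_smul,
      inv_mul_cancel₀ hNR, one_smul] at h
    exact h.fderiv
  have hequiv : ∀ z ∈ S.V, f (S.act g z) = T (f z) := by
    intro z hz
    -- Replacing `z` by `g z` shifts the index by one, up to `T`; `F N = F 0` closes the cycle.
    have hstep : ∀ j ∈ Finset.range N, F j (S.act g z) = T (F (j + 1) z) := by
      intro j hj
      have hj' := Finset.mem_range.1 hj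
      have e : N - j = (N - (j + 1)) + 1 := by omega
      change (T ^ (N - j)) (S.act (g ^ j) (S.act g z) - y) =
        T ((T ^ (N - (j + 1))) (S.act (g ^ (j + 1)) z - y))
      rw [← S.act_mul _ _ _ hz, ← pow_succ, e, pow_succ']
      rfl
    have hcyc : F N z = F 0 z := by
      change (T ^ (N - N)) (S.act (g ^ N) z - y) = (T ^ (N - 0)) (S.act (g ^ 0) z - y)
      rw [Nat.sub_self, Nat.sub_zero, hT, hg, pow_zero, pow_zero]
    change (N : ℝ)⁻¹ • ∑ j ∈ Finset.range N, F j (S.act g z) =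
      T ((N : ℝ)⁻¹ • ∑ j ∈ Finset.range N, F j z)
    rw [Finset.sum_congr rfl hstep, map_smul, ← map_sum]
    congr 2
    have h1 := Finset.sum_range_succ (fun j => F j z) N
    have h2 := Finset.sum_range_succ' (fun j => F j z) N
    rw [h1, hcyc] at h2
    exact (add_right_cancel h2).symm
  obtain ⟨φ, hyφ, hφV, hφ, hs, ht⟩ := exists_diffeomorph_of_fderiv_eq_one S.isOpen_V hf hy.1 hdf
  refine ⟨φ, hyφ, hφV, hs, ht, fun z hz => ?_⟩
  rw [hφ]
  exact hequiv z hz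

/-- The fixed-point set is a submanifold, of the dimension of the fixed space of the
differential. -/
lemma isSubmanifoldAt_fixedSet {g : S.G} {y : Euc m} (hy : y ∈ S.fixedSet g) :
    IsSubmanifoldAt (S.fixedSet g) y
      (Module.finrank ℝ (fixedSubspace (fderiv ℝ (S.act g) y))) := by
  obtain ⟨φ, hyφ, hφV, hs, ht, hequiv⟩ := exists_linearization hy
  -- With both `z` and `g z` in the source, injectivity of `φ` turns `T (φ z) = φ z` into `g z = z`.
  have hopen : IsOpen (φ.source ∩ S.act g ⁻¹' φ.source) :=
    ((S.smooth_act g).continuousOn.mono hφV).isOpen_inter_preimage φ.open_source φ.open_source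
  refine ⟨hy, φ.restrOpen _ hopen, ⟨hyφ, hyφ, ?_⟩, hs.mono fun x hx => hx.1,
    ht.mono fun x hx => hx.1, _, rfl, fun z hz => ?_⟩
  · change S.act g y ∈ φ.source
    rwa [hy.2]
  · have hz1 : z ∈ φ.source := hz.1
    have hz2 : S.act g z ∈ φ.source := hz.2.2
    change _ ↔ φ z ∈ _
    rw [mem_fixedSubspace, ← hequiv z (hφV hz1)]
    exact ⟨fun h => by rw [h.2], fun h => ⟨hφV hz1, φ.injOn hz2 hz1 h⟩⟩

end UniformizingSystem

/-- The local dimension at `y` is that of the fixed space of the differential there; the case `β =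
1` of constancy along the component carries it to the centre, where it is twice `fixedDim`. -/
lemma AlmostComplexStructure.hasSectorComplexDim {X : Type*} [TopologicalSpace X] {m : ℕ}
    {O : OrbifoldStructure X m} (A : AlmostComplexStructure O) {t : O.SectorIndex} {d : ℕ}
    (hd : ∀ a ∈ O.sector t, A.fixedDim a = d) : O.HasSectorComplexDim t d := by
  intro p g hpg y hy
  have hyf : y ∈ (O.chart p).fixedSet g := connectedComponentIn_subset _ _ hy
  have htw : ∀ z, A.localTwist p g 1 z = fderiv ℝ ((O.chart p).act g) z := fun z => by
    ext v; simp [localTwist, twist]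
  have h1 := A.finrank_fixedSubspace_localTwist_eq p (orderOf_pos g).ne' (one_pow _)
    (pow_orderOf_eq_one g) hy
  rw [A.finrank_fixedSubspace_localTwist_zero p g one_ne_zero, inv_one, ← A.fixedDim_point,
    hd _ hpg, htw] at h1
  rw [← h1]
  exact UniformizingSystem.isSubmanifoldAt_fixedSet hyf

/-! ### The main theorem. -/

theorem lemma3p2p1 {X : Type*} [TopologicalSpace X] [T2Space X] [SecondCountableTopology X]
    {n : ℕ} (O : OrbifoldStructure X (2 * n)) (A : AlmostComplexStructure O) :
    ∃ ι : O.SectorIndex → ℚ,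
      (∀ t, ∀ a ∈ O.sector t, A.degreeShift a = ι t) ∧
      (∀ (p : X) (g : O.locGroup p),
        (∃ k : ℤ, ι (O.sectorOf (O.point p g)) = k) ↔ LinearMap.det (A.rho p g) = 1) ∧
      (∀ (p : X) (g : O.locGroup p),
        ι (O.sectorOf (O.point p g)) + ι (O.sectorOf (O.point p g⁻¹)) =
          (Module.finrank ℂ (LinearMap.range (A.rho p g - 1)) : ℚ)) ∧
      (∀ t, ∃ d : ℕ, O.HasSectorComplexDim t d ∧
        ∀ (p : X) (g : O.locGroup p), O.point p g ∈ O.sector t →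
          (Module.finrank ℂ (LinearMap.range (A.rho p g - 1)) : ℤ) = (n : ℤ) - d ∧
          (A.rho p g ≠ 1 → ι t + (d : ℚ) < n)) := by
  have hfin : ∀ (p : X) (g : O.locGroup p), IsOfFinOrder (G := Module.End ℂ (A.TangentAt p))
      (A.rho p g) := fun p g => MonoidHom.isOfFinOrder (A.rho p) (isOfFinOrder_of_finite g)
  let ι : O.SectorIndex → ℚ := Quotient.lift A.degreeShift fun a b h =>
    OrbifoldStructure.eq_of_eqvGen (fun _ _ => A.degreeShift_eq_of_sectorStep) h
  have hι : ∀ (p : X) (g : O.locGroup p),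
      ι (O.sectorOf (O.point p g)) = shiftOfEnd (A.rho p g) := fun _ _ => rfl
  refine ⟨ι, ?_, fun p g => ?_, fun p g => ?_, fun t => ?_⟩
  · rintro t a rfl
    rfl
  · rw [hι]
    exact exists_int_shiftOfEnd_iff (hfin p g)
  · rw [hι, hι]
    have hmul : A.rho p g⁻¹ * A.rho p g = 1 := by rw [← map_mul, inv_mul_cancel, map_one]
    refine shiftOfEnd_add_shiftOfEnd_inv (hfin p g) hmul ?_
    rw [orderOf_eq_orderOf_iff]
    intro k
    -- The `k`-th powers are inverse to each other, so one is `1` exactly when the other is.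
    have hk : A.rho p g⁻¹ ^ k * A.rho p g ^ k = 1 := by
      rw [← map_pow, ← map_pow, ← map_mul, inv_pow, inv_mul_cancel, map_one]
    constructor
    · intro h; rwa [h, one_mul] at hk
    · intro h; rwa [h, mul_one] at hk
  · obtain ⟨a, rfl⟩ : ∃ a, O.sectorOf a = t := Quotient.exists_rep t
    have hd : ∀ b ∈ O.sector (O.sectorOf a), A.fixedDim b = A.fixedDim a := fun b hb =>
      OrbifoldStructure.eq_of_eqvGen (fun _ _ => A.fixedDim_eq_of_sectorStep)
        (Quotient.exact hb)
    refine ⟨A.fixedDim a, A.hasSectorComplexDim hd, fun p g hpg => ?_⟩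
    have hker : A.fixedDim a = Module.finrank ℂ (LinearMap.ker (A.rho p g - 1)) := by
      rw [← hd _ hpg, A.fixedDim_point, Module.End.eigenspace_def, one_smul]
    have hrn := LinearMap.finrank_range_add_finrank_ker (A.rho p g - 1)
    have hn := A.two_mul_finrank_tangentAt p
    -- Rank-nullity over `ℂ`: the fixed space is the kernel of `ρ_p(g) - 1`, and the tangent space
    -- has complex dimension `n`.
    have hsum : Module.finrank ℂ (LinearMap.range (A.rho p g - 1)) + A.fixedDim a = n := by
      omega
    refine ⟨by omega, fun h1 => ?_⟩
    -- The shift is compared directly with the rank, which is `n - d`; the shift of `g⁻¹` does not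
    -- enter.
    have hlt := shiftOfEnd_lt_finrank_range (hfin p g) h1
    rw [← hι p g, show O.sectorOf (O.point p g) = _ from hpg] at hlt
    have hsumQ : (Module.finrank ℂ (LinearMap.range (A.rho p g - 1)) : ℚ) + A.fixedDim a = n := by
      exact_mod_cast hsum
    exact hsumQ ▸ add_lt_add_of_lt_of_le hlt le_rfl
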